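/- Let $d\in\mathbb N$, let $|\cdot|$ be the Euclidean norm on $\mathbb R^d$, and let $\mathcal P_2(\mathbb R^d)$ be the set of probability measures on $\mathbb R^d$ with finite second order moment. For probability measures $\eta,\nu$ on $\mathbb R^d$, write $\eta\le_{\mathrm{cx}}\nu$ if $\int\phi\,d\eta\le\int\phi\,d\nu$ for each convex $\phi:\mathbb R^d\to\mathbb R$ such that both integrals make sense in $[-\infty,+\infty]$. For $\mu,\nu\in\mathcal P_2(\mathbb R^d)$, let $\Pi(\mu,\nu)$ be the set of couplings of $\mu$ and $\nu$, let $W_2^2(\mu,\nu)=\inf_{\pi\in\Pi(\mu,\nu)}\int|y-x|^2\,\pi(dx,dy)$, let $\Pi^{opt}(\mu,\nu)$ be the set of the couplings that attain this infimum, and define $$\mathcal I_\mu^\nu=\Big\{\eta\in\mathcal P_2(\mathbb R^d):\ \eta\le_{\mathrm{cx}}\nu\ \text{ and }\ W_2^2(\mu,\nu)=W_2^2(\mu,\eta)+\int|y|^2\,\nu(dy)-\int|z|^2\,\eta(dz)\Big\},$$ $$\tilde{\mathcal I}_\mu^\nu=\Big\{\mathcal T\#\mu:\ k \text{ a Markov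 kernel with } \mu(dx)k(x,dy)\in\Pi^{opt}(\mu,\nu),\ \mathcal T(x)=\int y\,k(x,dy)\Big\}.$$ Let $\mu,\nu\in\mathcal P_2(\mathbb R^d)$. Then: 1. If $\eta\in\mathcal I_\mu^\nu$, then for any probability measure $\tilde\eta$ on $\mathbb R^d$ such that $\eta\le_{\mathrm{cx}}\tilde\eta\le_{\mathrm{cx}}\nu$, one has $\tilde\eta\in\mathcal I_\mu^\nu$ and $\eta\in\mathcal I_\mu^{\tilde\eta}$. 2. $\mathcal I_\mu^\nu=\{\eta\in\mathcal P_2(\mathbb R^d):\ \exists\,\tilde\eta\in\tilde{\mathcal I}_\mu^\nu,\ \tilde\eta\le_{\mathrm{cx}}\eta\le_{\mathrm{cx}}\nu\}$. 3. The set $\mathcal I_\mu^\nu$ is convex. -/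

import Mathlib

open MeasureTheory ProbabilityTheory
open scoped ENNReal NNReal

/-- The Euclidean space `ℝ^d`. -/
abbrev Rd (d : ℕ) : Type := EuclideanSpace ℝ (Fin d)

/-- Probability measures on `ℝ^d` with finite second order moment. -/
def P2 (d : ℕ) : Set (Measure (Rd d)) :=
  {μ | IsProbabilityMeasure μ ∧ ∫⁻ x, ‖x‖ₑ ^ 2 ∂μ < ∞}

/-- The integral of `φ` makes sense in `[-∞, +∞]`: its positive part or its negative part has a
finite integral. -/
def IntegralMakesSense {d : ℕ} (φ : Rd d → ℝ) (μ : Measure (Rd d)) : Prop :=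
  ∫⁻ x, ENNReal.ofReal (φ x) ∂μ ≠ ∞ ∨ ∫⁻ x, ENNReal.ofReal (-φ x) ∂μ ≠ ∞

/-- The integral of `φ` with values in `[-∞, +∞]`, i.e. the integral of the positive part minus
that of the negative part; it is only used when `IntegralMakesSense φ μ`. -/
noncomputable def extIntegral {d : ℕ} (φ : Rd d → ℝ) (μ : Measure (Rd d)) : EReal :=
  ((∫⁻ x, ENNReal.ofReal (φ x) ∂μ : ℝ≥0∞) : EReal)
    - ((∫⁻ x, ENNReal.ofReal (-φ x) ∂μ : ℝ≥0∞) : EReal)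

/-- The convex order: `∫ φ dη ≤ ∫ φ dν` for each convex `φ : ℝ^d → ℝ` such that both integrals
make sense (possibly with infinite values). -/
def ConvexOrder {d : ℕ} (η ν : Measure (Rd d)) : Prop :=
  ∀ φ : Rd d → ℝ, ConvexOn ℝ Set.univ φ →
    IntegralMakesSense φ η → IntegralMakesSense φ ν → extIntegral φ η ≤ extIntegral φ ν

/-- The set of couplings of `μ` and `ν`. -/
def couplings {d : ℕ} (μ ν : Measure (Rd d)) : Set (Measure (Rd d × Rd d)) :=
  {π | π.map Prod.fst = μ ∧ π.map Prod.snd = ν}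

/-- The quadratic transport cost of a measure on `ℝ^d × ℝ^d`. -/
noncomputable def quadCost {d : ℕ} (π : Measure (Rd d × Rd d)) : ℝ≥0∞ :=
  ∫⁻ p, ‖p.2 - p.1‖ₑ ^ 2 ∂π

/-- The squared quadratic Wasserstein distance `W₂²(μ, ν)` (finite on `P2 d`). -/
noncomputable def W2sq {d : ℕ} (μ ν : Measure (Rd d)) : ℝ≥0∞ :=
  ⨅ π ∈ couplings μ ν, quadCost π

/-- The set of optimal couplings of `μ` and `ν`. -/
def optCouplings {d : ℕ} (μ ν : Measure (Rd d)) : Set (Measure (Rd d × Rd d)) :=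
  {π | π ∈ couplings μ ν ∧ quadCost π = W2sq μ ν}

/-- The set `𝓘_μ^ν`: the `η ∈ P2 d` with `η ≤ ν` in the convex order and
`W₂²(μ, ν) = W₂²(μ, η) + ∫ |y|² dν - ∫ |z|² dη`.
All the terms of the equation are finite for `μ, ν ∈ P2 d`. -/
def setI {d : ℕ} (μ ν : Measure (Rd d)) : Set (Measure (Rd d)) :=
  {η | η ∈ P2 d ∧ ConvexOrder η ν ∧
    (W2sq μ ν).toReal = (W2sq μ η).toReal + ∫ y, ‖y‖ ^ 2 ∂ν - ∫ z, ‖z‖ ^ 2 ∂η}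

/-- The barycentre map `x ↦ ∫ y k(x, dy)` of a kernel. -/
noncomputable def barycenterMap {d : ℕ} (k : Kernel (Rd d) (Rd d)) : Rd d → Rd d :=
  fun x => ∫ y, y ∂(k x)

/-- The set `𝓘̃_μ^ν` of the images of `μ` by the barycentre maps of the Markov kernels `k` such
that `μ(dx) k(x, dy)` is an optimal coupling of `μ` and `ν`. -/
def setITilde {d : ℕ} (μ ν : Measure (Rd d)) : Set (Measure (Rd d)) :=
  {θ | ∃ k : Kernel (Rd d) (Rd d), IsMarkovKernel k ∧ μ ⊗ₘ k ∈ optCouplings μ ν ∧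
    θ = μ.map (barycenterMap k)}

/-!
For couplings `π` of `μ` and `ν` the quadratic cost is `∫ |x|² dμ + ∫ |y|² dν - 2 ∫ ⟪x, y⟫ dπ`, so
`η ∈ 𝓘_μ^ν` if and only if `η ≤ ν` in the convex order and the maximal correlation of `μ` with `η`
equals that of `μ` with `ν`. The correlation of `μ(dx) k(x, dy)` depends on the kernel `k` through
its barycentre map only. Composing `k` with a martingale kernel from `η` to `ν`, given by Strassen's
theorem, leaves this map unchanged, so the maximal correlation is monotone in the convex order;
mixtures of couplings show that it is concave. Conversely, an optimal kernel from `μ` to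
`η ∈ 𝓘_μ^ν`, composed with such a martingale kernel, is optimal from `μ` to `ν`, and the image of
`μ` by its barycentre map lies below `η`.

Both the optimal couplings and the martingale couplings come from one duality statement: M. Riesz's
extension theorem yields a positive functional on the functions of at most quadratic growth with
the prescribed marginals, which is the integral against a measure.
-/

open Filter Topology Set
open scoped CompactlySupported BoundedContinuousFunction

section QuadraticGrowth

variable {X Y : Type*} [NormedAddCommGroup X] [NormedAddCommGroup Y]

/-- The space of continuous real functions of at most quadratic growth, the test functions for
measures with a finite second moment. -/
def quadGrowth (X : Type*) [NormedAddCommGroup X] : Submodule ℝ (X → ℝ) where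
  carrier := {f | Continuous f ∧ f =O[⊤] fun x => 1 + ‖x‖ ^ 2}
  zero_mem' := ⟨continuous_zero, Asymptotics.isBigO_zero _ _⟩
  add_mem' hf hg := ⟨hf.1.add hg.1, hf.2.add hg.2⟩
  smul_mem' c _ hf := ⟨hf.1.const_smul c, hf.2.const_smul_left c⟩

namespace quadGrowth

instance : CoeFun (quadGrowth X) fun _ => X → ℝ := ⟨Subtype.val⟩

instance : PosSMulMono ℝ (quadGrowth X) :=
  ⟨fun _ hc _ _ h x => mul_le_mul_of_nonneg_left (h x) hc⟩

lemma continuous (F : quadGrowth X) : Continuous F := F.2.1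

lemma exists_abs_le (F : quadGrowth X) : ∃ C, 0 ≤ C ∧ ∀ x, |F x| ≤ C * (1 + ‖x‖ ^ 2) := by
  obtain ⟨C, hC, h⟩ := F.2.2.exists_nonneg
  refine ⟨C, hC, fun x => (Asymptotics.isBigOWith_top.1 h x).trans_eq ?_⟩
  rw [Real.norm_of_nonneg (by positivity)]

lemma integrable [MeasurableSpace X] [OpensMeasurableSpace X] {μ : Measure X} [IsFiniteMeasure μ]
    (hμ : MemLp id 2 μ) (F : quadGrowth X) : Integrable F μ := by
  obtain ⟨C, -, hC⟩ := exists_abs_le F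
  exact (((integrable_const 1).add (hμ.integrable_norm_pow two_ne_zero)).const_mul C).mono'
    (continuous F).aestronglyMeasurable (ae_of_all _ hC)

end quadGrowth

lemma mem_quadGrowth_of_abs_le {f : X → ℝ} (hf : Continuous f) {C : ℝ}
    (hC : ∀ x, |f x| ≤ C * (1 + ‖x‖ ^ 2)) : f ∈ quadGrowth X :=
  ⟨hf, .of_bound C (Eventually.of_forall fun x => by
    rw [Real.norm_of_nonneg (by positivity : (0 : ℝ) ≤ 1 + ‖x‖ ^ 2)]; exact hC x)⟩

lemma mem_quadGrowth_of_bounded {f : X → ℝ} (hf : Continuous f) {C : ℝ} (hC : ∀ x, |f x| ≤ C) :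
    f ∈ quadGrowth X :=
  mem_quadGrowth_of_abs_le hf fun x =>
    (hC x).trans (le_mul_of_one_le_right ((abs_nonneg _).trans (hC x)) (by simp))

lemma one_add_norm_sq_mem_quadGrowth : (fun x : X => 1 + ‖x‖ ^ 2) ∈ quadGrowth X :=
  ⟨by fun_prop, Asymptotics.isBigO_refl _ _⟩

/-- The continuous cutoff equal to `1` on the ball of radius `n` and to `0` outside the ball of
radius `n + 1`. -/
noncomputable def ballCutoff (n : ℕ) (x : X) : ℝ := max 0 (min 1 (n + 1 - ‖x‖))

lemma continuous_ballCutoff (n : ℕ) : Continuous (ballCutoff n : X → ℝ) := by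
  unfold ballCutoff
  fun_prop

lemma ballCutoff_nonneg (n : ℕ) (x : X) : 0 ≤ ballCutoff n x := le_max_left _ _

lemma ballCutoff_le_one (n : ℕ) (x : X) : ballCutoff n x ≤ 1 :=
  max_le zero_le_one (min_le_left _ _)

lemma ballCutoff_eq_one {n : ℕ} {x : X} (h : ‖x‖ ≤ n) : ballCutoff n x = 1 := by
  rw [ballCutoff, min_eq_left (by linarith), max_eq_right zero_le_one]

lemma eventually_ballCutoff_eq_one (x : X) : ∀ᶠ n in atTop, ballCutoff n x = 1 := by
  filter_upwards [tendsto_natCast_atTop_atTop.eventually_ge_atTop ‖x‖] with n hn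
  exact ballCutoff_eq_one hn

lemma hasCompactSupport_ballCutoff [ProperSpace X] (n : ℕ) :
    HasCompactSupport (ballCutoff n : X → ℝ) := by
  refine HasCompactSupport.intro (isCompact_closedBall 0 (n + 1)) fun x hx => ?_
  rw [mem_closedBall_zero_iff, not_le] at hx
  exact max_eq_left ((min_le_right _ _).trans (by linarith))

/-- The weight `1 + ‖x‖²` cut off from the ball of radius `n`: a positive functional on
`quadGrowth X` loses no mass at infinity if its values at these functions tend to `0`. -/
noncomputable def quadTail (X : Type*) [NormedAddCommGroup X] (n : ℕ) : quadGrowth X :=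
  ⟨fun x => (1 + ‖x‖ ^ 2) * (1 - ballCutoff n x),
    mem_quadGrowth_of_abs_le (C := 1)
      (.mul (by fun_prop) (continuous_const.sub (continuous_ballCutoff n))) fun x => by
        have := ballCutoff_nonneg n x
        have := ballCutoff_le_one n x
        rw [abs_of_nonneg (by nlinarith [sq_nonneg ‖x‖])]
        nlinarith [sq_nonneg ‖x‖]⟩

lemma quadTail_nonneg (n : ℕ) (x : X) : 0 ≤ quadTail X n x :=
  mul_nonneg (by positivity) (sub_nonneg.2 (ballCutoff_le_one n x))

lemma quadTail_prod_le (n : ℕ) (p : X × Y) :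
    quadTail (X × Y) n p ≤ quadTail X n p.1 + quadTail Y n p.2 := by
  have h₁ := quadTail_nonneg n p.1
  have h₂ := quadTail_nonneg n p.2
  rcases max_choice ‖p.1‖ ‖p.2‖ with h | h
  · have : quadTail (X × Y) n p = quadTail X n p.1 := by
      simp only [quadTail, ballCutoff, Prod.norm_def, h]
    linarith
  · have : quadTail (X × Y) n p = quadTail Y n p.2 := by
      simp only [quadTail, ballCutoff, Prod.norm_def, h]
    linarith

lemma tendsto_integral_mul_ballCutoff [MeasurableSpace X] [OpensMeasurableSpace X] {μ : Measure X}
    {f : X → ℝ} (hf : Integrable f μ) :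
    Tendsto (fun n => ∫ x, f x * ballCutoff n x ∂μ) atTop (𝓝 (∫ x, f x ∂μ)) := by
  refine tendsto_integral_of_dominated_convergence (fun x => ‖f x‖)
    (fun n => hf.aestronglyMeasurable.mul (continuous_ballCutoff n).aestronglyMeasurable)
    hf.norm (fun n => ae_of_all _ fun x => ?_) (ae_of_all _ fun x => ?_)
  · rw [norm_mul, Real.norm_of_nonneg (ballCutoff_nonneg n x)]
    exact mul_le_of_le_one_right (norm_nonneg _) (ballCutoff_le_one n x)
  · refine tendsto_const_nhds.congr' ?_
    filter_upwards [eventually_ballCutoff_eq_one x] with n hn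
    rw [hn, mul_one]

lemma tendsto_integral_quadTail [MeasurableSpace X] [OpensMeasurableSpace X] {μ : Measure X}
    [IsFiniteMeasure μ] (hμ : MemLp id 2 μ) :
    Tendsto (fun n => ∫ x, quadTail X n x ∂μ) atTop (𝓝 0) := by
  let w : quadGrowth X := ⟨_, one_add_norm_sq_mem_quadGrowth⟩
  have hw : Integrable w μ := quadGrowth.integrable hμ w
  have hcut (n : ℕ) : ∫ x, quadTail X n x ∂μ = ∫ x, w x ∂μ - ∫ x, w x * ballCutoff n x ∂μ := by
    rw [← integral_sub hw (hw.mul_bdd (c := 1) (continuous_ballCutoff n).aestronglyMeasurable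
      (ae_of_all _ fun x => ?_))]
    · exact integral_congr_ae (ae_of_all _ fun x => mul_one_sub _ _)
    · rw [Real.norm_of_nonneg (ballCutoff_nonneg n x)]
      exact ballCutoff_le_one n x
  simp only [hcut]
  simpa only [sub_self] using (tendsto_integral_mul_ballCutoff hw).const_sub (∫ x, w x ∂μ)

end QuadraticGrowth

section Representation

variable {Z : Type*} [NormedAddCommGroup Z]

/-- Compactly supported continuous functions, as functions of at most quadratic growth. -/
def compactlySupportedToQuadGrowth (Z : Type*) [NormedAddCommGroup Z] :
    C_c(Z, ℝ) →ₚ[ℝ] quadGrowth Z :=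
  .mk₀
    { toFun f := ⟨f, by
        obtain ⟨C, hC⟩ := f.hasCompactSupport.exists_bound_of_continuous f.continuous
        exact mem_quadGrowth_of_bounded f.continuous hC⟩
      map_add' _ _ := rfl
      map_smul' _ _ := rfl }
    fun _ hf => hf

variable [ProperSpace Z]

/-- The product of a function of at most quadratic growth with `ballCutoff n`, a compactly supported
approximation to which the Riesz–Markov–Kakutani theorem applies. -/
noncomputable def quadGrowth.cutoff (F : quadGrowth Z) (n : ℕ) : C_c(Z, ℝ) where
  toFun z := F z * ballCutoff n z
  continuous_toFun := F.2.1.mul (continuous_ballCutoff n)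
  hasCompactSupport' := (hasCompactSupport_ballCutoff n).mul_left

lemma quadGrowth.tendsto_map_cutoff {L : quadGrowth Z →ₚ[ℝ] ℝ}
    (hL : Tendsto (fun n => L (quadTail Z n)) atTop (𝓝 0)) (F : quadGrowth Z) :
    Tendsto (fun n => L (compactlySupportedToQuadGrowth Z (cutoff F n))) atTop (𝓝 (L F)) := by
  obtain ⟨C, -, hF⟩ := exists_abs_le F
  have hle (n : ℕ) (z : Z) : |F z - F z * ballCutoff n z| ≤ C * quadTail Z n z := by
    rw [← mul_one_sub, abs_mul, abs_of_nonneg (sub_nonneg.2 (ballCutoff_le_one n z))]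
    exact (mul_le_mul_of_nonneg_right (hF z) (sub_nonneg.2 (ballCutoff_le_one n z))).trans_eq
      (mul_assoc _ _ _)
  refine tendsto_iff_dist_tendsto_zero.2 (squeeze_zero (fun _ => dist_nonneg) (fun n => ?_)
    (by simpa only [mul_zero] using hL.const_mul C))
  have hupper := OrderHomClass.mono L (show F - compactlySupportedToQuadGrowth Z (cutoff F n) ≤
    C • quadTail Z n from fun z => (abs_le.1 (hle n z)).2)
  have hlower := OrderHomClass.mono L (show -(C • quadTail Z n) ≤
    F - compactlySupportedToQuadGrowth Z (cutoff F n) from fun z => (abs_le.1 (hle n z)).1)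
  rw [map_sub, map_smul, smul_eq_mul] at hupper
  rw [map_sub, map_neg, map_smul, smul_eq_mul] at hlower
  rw [dist_comm, Real.dist_eq]
  exact abs_le.2 ⟨hlower, hupper⟩

variable [MeasurableSpace Z] [BorelSpace Z] {L : quadGrowth Z →ₚ[ℝ] ℝ} {π : Measure Z}

lemma integrable_one_add_norm_sq_of_integral_eq [IsFiniteMeasureOnCompacts π]
    (hπ : ∀ f : C_c(Z, ℝ), ∫ z, f z ∂π = L (compactlySupportedToQuadGrowth Z f)) :
    Integrable (fun z : Z => 1 + ‖z‖ ^ 2) π := by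
  let w : quadGrowth Z := ⟨_, one_add_norm_sq_mem_quadGrowth⟩
  have hw (z : Z) : 0 ≤ w z := by positivity
  have hloc (n : ℕ) : IntegrableOn w (Metric.closedBall 0 n) π :=
    (quadGrowth.continuous w).continuousOn.integrableOn_compact (isCompact_closedBall 0 _)
  have hcover := aecover_closedBall (μ := π) (x := (0 : Z)) tendsto_natCast_atTop_atTop
  refine hcover.integrable_of_integral_bounded_of_nonneg_ae (L w) hloc (ae_of_all _ hw)
    (Eventually.of_forall fun n => ?_)
  calc ∫ z in Metric.closedBall 0 n, w z ∂π
      = ∫ z in Metric.closedBall 0 n, quadGrowth.cutoff w n z ∂π :=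
        setIntegral_congr_fun Metric.isClosed_closedBall.measurableSet fun z hz => by
          simp [quadGrowth.cutoff, ballCutoff_eq_one (mem_closedBall_zero_iff.1 hz)]
    _ ≤ ∫ z, quadGrowth.cutoff w n z ∂π :=
        setIntegral_le_integral (CompactlySupportedContinuousMap.integrable _)
          (ae_of_all _ fun z => mul_nonneg (hw z) (ballCutoff_nonneg n z))
    _ = L (compactlySupportedToQuadGrowth Z (quadGrowth.cutoff w n)) := hπ _
    _ ≤ L w := OrderHomClass.mono L fun z =>
        mul_le_of_le_one_right (hw z) (ballCutoff_le_one n z)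

/-- The condition `hL` excludes mass escaping to infinity, which the Riesz–Markov–Kakutani
theorem alone does not see. -/
theorem exists_measure_integral_eq (hL : Tendsto (fun n => L (quadTail Z n)) atTop (𝓝 0)) :
    ∃ π : Measure Z, IsFiniteMeasure π ∧ MemLp id 2 π ∧ ∀ F : quadGrowth Z, ∫ z, F z ∂π = L F := by
  set Λ := L.comp (compactlySupportedToQuadGrowth Z)
  set π := RealRMK.rieszMeasure Λ
  have hΛ (f : C_c(Z, ℝ)) : ∫ z, f z ∂π = Λ f := RealRMK.integral_rieszMeasure Λ f
  have hint := integrable_one_add_norm_sq_of_integral_eq hΛ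
  have hfin : IsFiniteMeasure π := by
    refine (integrable_const_iff_isFiniteMeasure (one_ne_zero (α := ℝ))).1 ?_
    exact hint.mono' aestronglyMeasurable_const (ae_of_all _ fun z => by simp)
  have hmom : MemLp id 2 π :=
    (memLp_two_iff_integrable_sq_norm aestronglyMeasurable_id).2
      (hint.mono' (by fun_prop) (ae_of_all _ fun z => by simp))
  refine ⟨π, hfin, hmom, fun F => ?_⟩
  refine tendsto_nhds_unique (tendsto_integral_mul_ballCutoff (quadGrowth.integrable hmom F)) ?_
  exact (quadGrowth.tendsto_map_cutoff hL F).congr fun n => (hΛ (quadGrowth.cutoff F n)).symm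

end Representation

section CouplingDuality

lemma isProbabilityMeasure_of_fst {α β : Type*} [MeasurableSpace α] [MeasurableSpace β]
    {π : Measure (α × β)} (h : IsProbabilityMeasure π.fst) : IsProbabilityMeasure π :=
  (Measure.isProbabilityMeasure_map_iff measurable_fst.aemeasurable).1 h

variable {X Y : Type*} [NormedAddCommGroup X] [NormedAddCommGroup Y]

/-- The functions `(x, y) ↦ g x + h y` of at most quadratic growth, on which the integral against a
coupling depends on its marginals only. -/
def tensorSum : quadGrowth X × quadGrowth Y →ₗ[ℝ] quadGrowth (X × Y) where
  toFun q := ⟨fun p => q.1 p.1 + q.2 p.2, by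
    obtain ⟨C, hC, hg⟩ := quadGrowth.exists_abs_le q.1
    obtain ⟨D, hD, hh⟩ := quadGrowth.exists_abs_le q.2
    refine mem_quadGrowth_of_abs_le (C := C + D) (.add ((quadGrowth.continuous _).comp
      continuous_fst) ((quadGrowth.continuous _).comp continuous_snd)) fun p => ?_
    calc |q.1 p.1 + q.2 p.2| ≤ C * (1 + ‖p.1‖ ^ 2) + D * (1 + ‖p.2‖ ^ 2) :=
          (abs_add_le _ _).trans (add_le_add (hg _) (hh _))
      _ ≤ C * (1 + ‖p‖ ^ 2) + D * (1 + ‖p‖ ^ 2) := by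
          gcongr
          exacts [norm_fst_le p, norm_snd_le p]
      _ = (C + D) * (1 + ‖p‖ ^ 2) := by ring⟩
  map_add' _ _ := Subtype.ext (funext fun _ => add_add_add_comm _ _ _ _)
  map_smul' _ _ := Subtype.ext (funext fun _ => (mul_add _ _ _).symm)

lemma exists_abs_le_tensorSum (F : quadGrowth (X × Y)) :
    ∃ q : quadGrowth X × quadGrowth Y, ∀ p, |F p| ≤ tensorSum q p := by
  obtain ⟨C, hC, hF⟩ := quadGrowth.exists_abs_le F
  refine ⟨(C • ⟨_, one_add_norm_sq_mem_quadGrowth⟩, C • ⟨_, one_add_norm_sq_mem_quadGrowth⟩),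
    fun p => (hF p).trans ?_⟩
  calc C * (1 + ‖p‖ ^ 2) ≤ C * ((1 + ‖p.1‖ ^ 2) + (1 + ‖p.2‖ ^ 2)) := by
        refine mul_le_mul_of_nonneg_left ?_ hC
        rcases max_choice ‖p.1‖ ‖p.2‖ with h | h <;> rw [Prod.norm_def, h] <;>
          linarith [sq_nonneg ‖p.1‖, sq_nonneg ‖p.2‖]
    _ = C * (1 + ‖p.1‖ ^ 2) + C * (1 + ‖p.2‖ ^ 2) := mul_add _ _ _

variable [MeasurableSpace X] [MeasurableSpace Y]

lemma memLp_id_of_marginals {π : Measure (X × Y)} (hfst : MemLp id 2 π.fst)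
    (hsnd : MemLp id 2 π.snd) : MemLp id 2 π :=
  memLp_prod_iff.2 ⟨hfst.comp_measurePreserving ⟨measurable_fst, rfl⟩,
    hsnd.comp_measurePreserving ⟨measurable_snd, rfl⟩⟩

variable [BorelSpace X] [BorelSpace Y]

/-- Integration of functions of at most quadratic growth, as a linear form. -/
noncomputable def quadGrowth.integral {μ : Measure X} [IsFiniteMeasure μ] (hμ : MemLp id 2 μ) :
    quadGrowth X →ₗ[ℝ] ℝ where
  toFun F := ∫ x, F x ∂μ
  map_add' F G := integral_add (integrable hμ F) (integrable hμ G)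
  map_smul' c F := integral_const_mul c F

lemma integral_tensorSum {π : Measure (X × Y)} [IsFiniteMeasure π] (hfst : MemLp id 2 π.fst)
    (hsnd : MemLp id 2 π.snd) (g : quadGrowth X) (h : quadGrowth Y) :
    ∫ p, tensorSum (g, h) p ∂π = ∫ x, g x ∂π.fst + ∫ y, h y ∂π.snd := by
  have hg := quadGrowth.integrable hfst g
  have hh := quadGrowth.integrable hsnd h
  rw [Measure.fst, Measure.snd, integral_map measurable_fst.aemeasurable hg.aestronglyMeasurable,
    integral_map measurable_snd.aemeasurable hh.aestronglyMeasurable]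
  exact integral_add (hg.comp_measurable measurable_fst) (hh.comp_measurable measurable_snd)

lemma integral_le_of_le_tensorSum [SecondCountableTopology X] {π : Measure (X × Y)}
    [IsFiniteMeasure π] (hfst : MemLp id 2 π.fst) (hsnd : MemLp id 2 π.snd) {F : quadGrowth (X × Y)}
    {g : quadGrowth X} {h : quadGrowth Y} (hF : F ≤ tensorSum (g, h)) :
    ∫ p, F p ∂π ≤ ∫ x, g x ∂π.fst + ∫ y, h y ∂π.snd := by
  have hπ := memLp_id_of_marginals hfst hsnd
  rw [← integral_tensorSum hfst hsnd]
  exact integral_mono (quadGrowth.integrable hπ F) (quadGrowth.integrable hπ _) hF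

variable {μ : Measure X} {ν : Measure Y}

lemma bddAbove_integral_coupling [SecondCountableTopology X] [IsProbabilityMeasure μ]
    (hμ : MemLp id 2 μ) (hν : MemLp id 2 ν) (c : quadGrowth (X × Y)) :
    BddAbove {r | ∃ π : Measure (X × Y), π.fst = μ ∧ π.snd = ν ∧ ∫ p, c p ∂π = r} := by
  obtain ⟨⟨g, h⟩, hc⟩ := exists_abs_le_tensorSum c
  refine ⟨∫ x, g x ∂μ + ∫ y, h y ∂ν, ?_⟩
  rintro _ ⟨π, rfl, rfl, rfl⟩
  have := isProbabilityMeasure_of_fst (π := π) inferInstance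
  exact integral_le_of_le_tensorSum hμ hν fun p => (le_abs_self _).trans (hc p)

variable [ProperSpace X] [ProperSpace Y]

theorem exists_coupling_of_positiveLinearMap [IsFiniteMeasure μ] [IsFiniteMeasure ν]
    (hμ : MemLp id 2 μ) (hν : MemLp id 2 ν) (L : quadGrowth (X × Y) →ₚ[ℝ] ℝ)
    (hL : ∀ g h, L (tensorSum (g, h)) = ∫ x, g x ∂μ + ∫ y, h y ∂ν) :
    ∃ π : Measure (X × Y), π.fst = μ ∧ π.snd = ν ∧ ∀ F : quadGrowth (X × Y), ∫ p, F p ∂π = L F := by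
  have htail : Tendsto (fun n => L (quadTail (X × Y) n)) atTop (𝓝 0) := by
    have hsum := (tendsto_integral_quadTail hμ).add (tendsto_integral_quadTail hν)
    rw [add_zero] at hsum
    refine squeeze_zero (fun n => L.map_nonneg (quadTail_nonneg n)) (fun n => ?_) hsum
    rw [← hL]
    exact OrderHomClass.mono L (quadTail_prod_le n)
  obtain ⟨π, _, -, hπ⟩ := exists_measure_integral_eq htail
  refine ⟨π, ext_of_forall_integral_eq_of_IsFiniteMeasure fun f => ?_,
    ext_of_forall_integral_eq_of_IsFiniteMeasure fun f => ?_, hπ⟩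
  · have h := hL ⟨f, mem_quadGrowth_of_bounded f.continuous f.norm_coe_le_norm⟩ 0
    rw [← hπ] at h
    rw [Measure.fst, integral_map measurable_fst.aemeasurable f.continuous.aestronglyMeasurable]
    simpa [tensorSum] using h
  · have h := hL 0 ⟨f, mem_quadGrowth_of_bounded f.continuous f.norm_coe_le_norm⟩
    rw [← hπ] at h
    rw [Measure.snd, integral_map measurable_snd.aemeasurable f.continuous.aestronglyMeasurable]
    simpa [tensorSum] using h

/-- By M. Riesz's extension theorem, for the cone spanned by `K` and the nonnegative functions, the
functional prescribed by the marginals extends to a positive one that is nonnegative on `K`. -/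
theorem exists_coupling_integral_nonneg [IsProbabilityMeasure μ] [IsProbabilityMeasure ν]
    (hμ : MemLp id 2 μ) (hν : MemLp id 2 ν) (K : PointedCone ℝ (quadGrowth (X × Y)))
    (hdual : ∀ g h, ∀ F ∈ K, F ≤ tensorSum (g, h) → 0 ≤ ∫ x, g x ∂μ + ∫ y, h y ∂ν) :
    ∃ π : Measure (X × Y), π.fst = μ ∧ π.snd = ν ∧ ∀ F ∈ K, 0 ≤ ∫ p, F p ∂π := by
  have hfst : MemLp id 2 (μ.prod ν).fst := by rwa [Measure.fst_prod]
  have hsnd : MemLp id 2 (μ.prod ν).snd := by rwa [Measure.snd_prod]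
  have hprod (g : quadGrowth X) (h : quadGrowth Y) :
      ∫ p, tensorSum (g, h) p ∂μ.prod ν = ∫ x, g x ∂μ + ∫ y, h y ∂ν := by
    simpa only [Measure.fst_prod, Measure.snd_prod] using integral_tensorSum hfst hsnd g h
  let I := (quadGrowth.integral (memLp_id_of_marginals hfst hsnd)).toPMap
    (tensorSum (X := X) (Y := Y)).range
  have hI : ∀ q : I.domain, (q : quadGrowth (X × Y)) ∈ K ⊔ .positive ℝ _ → 0 ≤ I q := by
    rintro ⟨_, ⟨g, h⟩, rfl⟩ hgh
    obtain ⟨F, hF, P, hP, hFP⟩ := Submodule.mem_sup.1 hgh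
    refine (hdual g h F hF ?_).trans_eq (hprod g h).symm
    exact (le_add_of_nonneg_right hP).trans_eq hFP
  obtain ⟨L, hLI, hLK⟩ := riesz_extension _ I hI fun F => by
    obtain ⟨q, hq⟩ := exists_abs_le_tensorSum F
    refine ⟨⟨tensorSum q, q, rfl⟩, Submodule.mem_sup_right fun p => ?_⟩
    exact neg_le_iff_add_nonneg.1 ((neg_le_abs (F p)).trans (hq p))
  obtain ⟨π, hπfst, hπsnd, hπ⟩ := exists_coupling_of_positiveLinearMap hμ hν
    (.mk₀ L fun F hF => hLK F (Submodule.mem_sup_right hF))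
    fun g h => (hLI ⟨tensorSum (g, h), (g, h), rfl⟩).trans (hprod g h)
  exact ⟨π, hπfst, hπsnd, fun F hF => (hLK F (Submodule.mem_sup_left hF)).trans_eq (hπ F).symm⟩

theorem exists_coupling_integral_maximal [IsProbabilityMeasure μ] [IsProbabilityMeasure ν]
    (hμ : MemLp id 2 μ) (hν : MemLp id 2 ν) (c : quadGrowth (X × Y)) :
    ∃ π : Measure (X × Y), π.fst = μ ∧ π.snd = ν ∧
      ∀ ρ : Measure (X × Y), ρ.fst = μ → ρ.snd = ν → ∫ p, c p ∂ρ ≤ ∫ p, c p ∂π := by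
  let values : Set ℝ := {r | ∃ ρ : Measure (X × Y), ρ.fst = μ ∧ ρ.snd = ν ∧ ∫ p, c p ∂ρ = r}
  have hne : values.Nonempty := ⟨_, μ.prod ν, Measure.fst_prod, Measure.snd_prod, rfl⟩
  obtain ⟨s, hs⟩ := Real.exists_isLUB hne (bddAbove_integral_coupling hμ hν c)
  let e : quadGrowth (X × Y) :=
    c - ⟨fun _ => s, mem_quadGrowth_of_bounded continuous_const fun _ => le_rfl⟩
  have hexcess {ρ : Measure (X × Y)} (hfst : ρ.fst = μ) (hsnd : ρ.snd = ν) :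
      ∫ p, e p ∂ρ = ∫ p, c p ∂ρ - s := by
    subst hfst hsnd
    have := isProbabilityMeasure_of_fst (π := ρ) inferInstance
    have hc := quadGrowth.integrable (memLp_id_of_marginals hμ hν) c
    exact (integral_sub hc (integrable_const _)).trans (by simp)
  have hdual : ∀ g h, ∀ F ∈ PointedCone.hull ℝ {e}, F ≤ tensorSum (g, h) →
      0 ≤ ∫ x, g x ∂μ + ∫ y, h y ∂ν := by
    rintro g h _ hF hgh
    obtain ⟨t, rfl⟩ := Submodule.mem_span_singleton.1 hF
    have hvalues : values ⊆ {r | t * (r - s) ≤ ∫ x, g x ∂μ + ∫ y, h y ∂ν} := by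
      rintro _ ⟨ρ, hfst, hsnd, rfl⟩
      rw [mem_ofPred, ← hexcess hfst hsnd, ← integral_const_mul]
      subst hfst hsnd
      have := isProbabilityMeasure_of_fst (π := ρ) inferInstance
      exact integral_le_of_le_tensorSum hμ hν hgh
    have hclosed : IsClosed {r | t * (r - s) ≤ ∫ x, g x ∂μ + ∫ y, h y ∂ν} :=
      isClosed_le (by fun_prop) continuous_const
    simpa using closure_minimal hvalues hclosed (hs.mem_closure hne)
  obtain ⟨π, hπfst, hπsnd, hπ⟩ := exists_coupling_integral_nonneg hμ hν (.hull ℝ {e}) hdual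
  have hmax := hπ e (PointedCone.subset_hull rfl)
  rw [hexcess hπfst hπsnd, sub_nonneg] at hmax
  exact ⟨π, hπfst, hπsnd, fun ρ h₁ h₂ => (hs.1 ⟨ρ, h₁, h₂, rfl⟩).trans hmax⟩

end CouplingDuality

section ConvexOrder

section AffineMinorant

variable {E : Type*} [NormedAddCommGroup E] [NormedSpace ℝ E] [FiniteDimensional ℝ E] {φ : E → ℝ}

lemma exists_affine_le_of_convexOn (hφ : ConvexOn ℝ univ φ) :
    ∃ (l : E →L[ℝ] ℝ) (c : ℝ), ∀ x, l x + c ≤ φ x := by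
  obtain ⟨l, c, h, -⟩ := ConvexOn.exists_affine_le_of_lt (𝕜 := ℝ) (x := 0) (a := φ 0 - 1)
    (mem_univ _) (sub_one_lt _) isClosed_univ
    (hφ.locallyLipschitz.continuous.lowerSemicontinuous.lowerSemicontinuousOn _) hφ
  exact ⟨l, c, fun x => h ⟨x, mem_univ x⟩⟩

lemma lintegral_ofReal_neg_ne_top [MeasurableSpace E] {μ : Measure E} [IsFiniteMeasure μ]
    (hμ : Integrable id μ) (hφ : ConvexOn ℝ univ φ) : ∫⁻ x, ENNReal.ofReal (-φ x) ∂μ ≠ ∞ := by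
  obtain ⟨l, c, h⟩ := exists_affine_le_of_convexOn hφ
  have hint := ((l.integrable_comp hμ).add (integrable_const c)).neg
  exact ne_top_of_le_ne_top hint.lintegral_lt_top.ne
    (lintegral_mono fun x => ENNReal.ofReal_le_ofReal (neg_le_neg (h x)))

end AffineMinorant

variable {d : ℕ} {μ ν η : Measure (Rd d)} {φ : Rd d → ℝ}

lemma extIntegral_of_integrable (h : Integrable φ μ) :
    extIntegral φ μ = ((∫ x, φ x ∂μ : ℝ) : EReal) := by
  rw [integral_eq_lintegral_pos_part_sub_lintegral_neg_part h, EReal.coe_sub,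
    EReal.coe_ennreal_toReal h.lintegral_lt_top.ne,
    EReal.coe_ennreal_toReal (by simpa only [Pi.neg_apply] using h.neg.lintegral_lt_top.ne)]
  rfl

lemma extIntegral_eq_top_of_not_integrable (hmeas : AEMeasurable φ μ)
    (hneg : ∫⁻ x, ENNReal.ofReal (-φ x) ∂μ ≠ ∞) (hφ : ¬ Integrable φ μ) :
    extIntegral φ μ = ⊤ := by
  have hpos : ∫⁻ x, ENNReal.ofReal (φ x) ∂μ = ∞ := by
    by_contra hpos
    refine hφ ?_
    convert (integrable_toReal_of_lintegral_ne_top hmeas.ennreal_ofReal hpos).sub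
      (integrable_toReal_of_lintegral_ne_top hmeas.neg.ennreal_ofReal hneg) using 1
    ext x
    simp only [Pi.sub_apply, Pi.neg_apply, ENNReal.toReal_ofReal']
    grind
  rw [extIntegral, hpos, EReal.coe_ennreal_top, EReal.top_sub (by simpa using hneg)]

lemma convexOrder_iff [IsFiniteMeasure η] [IsFiniteMeasure ν] (hη : Integrable id η)
    (hν : Integrable id ν) :
    ConvexOrder η ν ↔ ∀ φ : Rd d → ℝ, ConvexOn ℝ univ φ → Integrable φ ν →
      Integrable φ η ∧ ∫ x, φ x ∂η ≤ ∫ x, φ x ∂ν := by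
  have htop {φ : Rd d → ℝ} {μ : Measure (Rd d)} [IsFiniteMeasure μ] (hμ : Integrable id μ)
      (hφ : ConvexOn ℝ univ φ) : ¬ Integrable φ μ → extIntegral φ μ = ⊤ :=
    extIntegral_eq_top_of_not_integrable hφ.locallyLipschitz.continuous.aemeasurable
      (lintegral_ofReal_neg_ne_top hμ hφ)
  refine ⟨fun h φ hφ hφν => ?_, fun h φ hφ _ _ => ?_⟩
  · have hle := h φ hφ (.inr (lintegral_ofReal_neg_ne_top hη hφ))
      (.inr (lintegral_ofReal_neg_ne_top hν hφ))
    rw [extIntegral_of_integrable hφν] at hle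
    have hφη : Integrable φ η := by
      by_contra hφη
      rw [htop hη hφ hφη, top_le_iff] at hle
      exact EReal.coe_ne_top _ hle
    rw [extIntegral_of_integrable hφη] at hle
    exact ⟨hφη, EReal.coe_le_coe_iff.1 hle⟩
  · by_cases hφν : Integrable φ ν
    · obtain ⟨hφη, hle⟩ := h φ hφ hφν
      rw [extIntegral_of_integrable hφη, extIntegral_of_integrable hφν]
      exact EReal.coe_le_coe_iff.2 hle
    · exact (htop hν hφ hφν).symm ▸ le_top

lemma mem_P2_iff : μ ∈ P2 d ↔ IsProbabilityMeasure μ ∧ MemLp id 2 μ := by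
  refine and_congr_right fun _ => ?_
  rw [memLp_two_iff_integrable_sq_norm aestronglyMeasurable_id, Integrable, HasFiniteIntegral]
  simp only [id, enorm_pow, enorm_norm]
  exact (and_iff_right (by fun_prop)).symm

lemma integrable_id_of_mem_P2 (hμ : μ ∈ P2 d) : Integrable id μ :=
  have := hμ.1
  (mem_P2_iff.1 hμ).2.integrable one_le_two

lemma ConvexOrder.mem_P2 [IsProbabilityMeasure η] (h : ConvexOrder η ν) (hν : ν ∈ P2 d) :
    η ∈ P2 d := by
  refine ⟨inferInstance, ?_⟩
  have hneg (x : Rd d) : ENNReal.ofReal (-‖x‖ ^ 2) = 0 :=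
    ENNReal.ofReal_of_nonpos (neg_nonpos.2 (by positivity))
  have hpos (x : Rd d) : ENNReal.ofReal (‖x‖ ^ 2) = ‖x‖ₑ ^ 2 := by
    rw [ENNReal.ofReal_pow (norm_nonneg x), ofReal_norm]
  have hle := h _ (convexOn_univ_norm.pow (fun _ _ => norm_nonneg _) 2)
    (.inr (by simp [hneg])) (.inr (by simp [hneg]))
  simp only [extIntegral, Pi.pow_apply, hneg, hpos, lintegral_zero, EReal.coe_ennreal_zero,
    sub_zero, EReal.coe_ennreal_le_coe_ennreal_iff] at hle
  exact hle.trans_lt hν.2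

end ConvexOrder

section Barycenter

section KernelIntegral

variable {α β E : Type*} [MeasurableSpace α] [MeasurableSpace β] [NormedAddCommGroup E]
  [NormedSpace ℝ E] {μ : Measure α} {k : Kernel α β} {f : β → E}

lemma integrable_integral_kernel (hf : Integrable f (k ∘ₘ μ)) :
    Integrable (fun x => ∫ y, f y ∂k x) μ := by
  rw [Measure.comp_eq_comp_const_apply] at hf
  exact hf.integral_comp

lemma integral_integral_kernel (hf : Integrable f (k ∘ₘ μ)) :
    ∫ x, ∫ y, f y ∂k x ∂μ = ∫ y, f y ∂(k ∘ₘ μ) := by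
  rw [Measure.comp_eq_comp_const_apply] at hf ⊢
  exact (Kernel.integral_comp hf).symm

end KernelIntegral

variable {d : ℕ} {μ : Measure (Rd d)} {k : Kernel (Rd d) (Rd d)}

lemma measurable_barycenterMap [IsSFiniteKernel k] : Measurable (barycenterMap k) :=
  stronglyMeasurable_id.integral_kernel.measurable

lemma integrable_barycenterMap (hk : Integrable id (k ∘ₘ μ)) : Integrable (barycenterMap k) μ :=
  integrable_integral_kernel hk

lemma barycenterMap_comp_ae_eq {m : Kernel (Rd d) (Rd d)} (hmk : Integrable id (m ∘ₘ k ∘ₘ μ))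
    (hm : barycenterMap m =ᵐ[k ∘ₘ μ] id) : barycenterMap (m ∘ₖ k) =ᵐ[μ] barycenterMap k := by
  filter_upwards [Measure.ae_ae_of_ae_comp hm,
    Measure.ae_integrable_of_integrable_comp (Measure.comp_assoc ▸ hmk)] with x hmx hx
  exact (Kernel.integral_comp hx).trans (integral_congr_ae hmx)

variable {φ : Rd d → ℝ} [IsMarkovKernel k]

lemma ae_apply_barycenterMap_le (hk : Integrable id (k ∘ₘ μ)) (hφ : ConvexOn ℝ univ φ)
    (hφk : Integrable φ (k ∘ₘ μ)) : ∀ᵐ x ∂μ, φ (barycenterMap k x) ≤ ∫ y, φ y ∂k x := by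
  filter_upwards [Measure.ae_integrable_of_integrable_comp hk,
    Measure.ae_integrable_of_integrable_comp hφk] with x hx hφx
  exact hφ.map_integral_le hφ.locallyLipschitz.continuous.continuousOn isClosed_univ
    (ae_of_all _ fun _ => mem_univ _) hx hφx

lemma integrable_comp_barycenterMap [IsFiniteMeasure μ] (hk : Integrable id (k ∘ₘ μ))
    (hφ : ConvexOn ℝ univ φ) (hφk : Integrable φ (k ∘ₘ μ)) :
    Integrable (fun x => φ (barycenterMap k x)) μ := by
  obtain ⟨l, c, hlc⟩ := exists_affine_le_of_convexOn hφ
  refine integrable_of_le_of_le ?_ (ae_of_all _ fun x => hlc (barycenterMap k x))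
    (ae_apply_barycenterMap_le hk hφ hφk)
    ((l.integrable_comp (integrable_barycenterMap hk)).add (integrable_const c))
    (integrable_integral_kernel hφk)
  exact (hφ.locallyLipschitz.continuous.measurable.comp
    measurable_barycenterMap).aestronglyMeasurable

lemma integral_comp_barycenterMap_le [IsFiniteMeasure μ] (hk : Integrable id (k ∘ₘ μ))
    (hφ : ConvexOn ℝ univ φ) (hφk : Integrable φ (k ∘ₘ μ)) :
    ∫ x, φ (barycenterMap k x) ∂μ ≤ ∫ y, φ y ∂(k ∘ₘ μ) := by
  rw [← integral_integral_kernel hφk]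
  exact integral_mono_ae (integrable_comp_barycenterMap hk hφ hφk)
    (integrable_integral_kernel hφk) (ae_apply_barycenterMap_le hk hφ hφk)

lemma convexOrder_map_barycenterMap [IsFiniteMeasure μ] (hk : Integrable id (k ∘ₘ μ)) :
    ConvexOrder (μ.map (barycenterMap k)) (k ∘ₘ μ) := by
  have hT : AEMeasurable (barycenterMap k) μ := measurable_barycenterMap.aemeasurable
  have hmap : Integrable id (μ.map (barycenterMap k)) :=
    (integrable_map_measure aestronglyMeasurable_id hT).2 (integrable_barycenterMap hk)
  refine (convexOrder_iff hmap hk).2 fun φ hφ hφk => ?_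
  have hφm := hφ.locallyLipschitz.continuous.aestronglyMeasurable (μ := μ.map (barycenterMap k))
  rw [integrable_map_measure hφm hT, integral_map hT hφm]
  exact ⟨integrable_comp_barycenterMap hk hφ hφk, integral_comp_barycenterMap_le hk hφ hφk⟩

end Barycenter

section Strassen

section TestFunctions

variable {E : Type*} [NormedAddCommGroup E] [InnerProductSpace ℝ E]

/-- The functions `(x, y) ↦ ⟪b x, y - x⟫`, whose integrals against a coupling all vanish if and
only if the coupling is the law of a martingale with two steps. -/
noncomputable def martingaleTest : (E →ᵇ E) →ₗ[ℝ] quadGrowth (E × E) where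
  toFun b := ⟨fun p => inner ℝ (b p.1) (p.2 - p.1),
    mem_quadGrowth_of_abs_le (C := ‖b‖ * 2) (by fun_prop) fun p => by
      rw [mul_assoc]
      refine (abs_real_inner_le_norm _ _).trans ?_
      gcongr
      · exact b.norm_coe_le_norm _
      · nlinarith [norm_sub_le p.2 p.1, norm_fst_le p, norm_snd_le p, sq_nonneg (‖p‖ - 1)]⟩
  map_add' _ _ := Subtype.ext (funext fun _ => inner_add_left _ _ _)
  map_smul' _ _ := Subtype.ext (funext fun _ => real_inner_smul_left _ _ _)

lemma convexOn_iSup {ι V : Type*} [Nonempty ι] [AddCommGroup V] [Module ℝ V]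
    {f : ι → V → ℝ} (hf : ∀ i, ConvexOn ℝ univ (f i))
    (hbdd : ∀ y, BddAbove (range fun i => f i y)) : ConvexOn ℝ univ fun y => ⨆ i, f i y := by
  refine ⟨convex_univ, fun x _ y _ a b ha hb hab => ciSup_le fun i => ?_⟩
  refine ((hf i).2 (mem_univ x) (mem_univ y) ha hb hab).trans ?_
  exact add_le_add (mul_le_mul_of_nonneg_left (le_ciSup (hbdd x) i) ha)
    (mul_le_mul_of_nonneg_left (le_ciSup (hbdd y) i) hb)

lemma exists_convexOn_between {b : E →ᵇ E} {g h : quadGrowth E}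
    (hb : martingaleTest b ≤ tensorSum (g, h)) :
    ∃ ψ : E → ℝ, ConvexOn ℝ univ ψ ∧ (∀ x, -g x ≤ ψ x) ∧ ∀ y, ψ y ≤ h y := by
  have hle (x y : E) : inner ℝ (b x) (y - x) - g x ≤ h y := sub_le_iff_le_add'.2 (hb (x, y))
  have hbdd (y : E) : BddAbove (range fun x => inner ℝ (b x) (y - x) - g x) :=
    ⟨h y, forall_mem_range.2 fun x => hle x y⟩
  have haffine (x : E) : ConvexOn ℝ univ fun y => inner ℝ (b x) (y - x) - g x := by
    simp only [inner_sub_right, sub_sub]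
    exact ((innerₛₗ ℝ (b x)).convexOn convex_univ).sub (concaveOn_const _ convex_univ)
  refine ⟨_, convexOn_iSup haffine hbdd, fun x => ?_, fun y => ciSup_le fun x => hle x y⟩
  simpa using le_ciSup (hbdd x) x

lemma ae_eq_zero_of_integral_inner_eq_zero [FiniteDimensional ℝ E] [MeasurableSpace E]
    [BorelSpace E] {μ : Measure E} {f : E → E} (hf : Integrable f μ)
    (h : ∀ b : E →ᵇ E, ∫ x, inner ℝ (b x) (f x) ∂μ = 0) : f =ᵐ[μ] 0 := by
  refine ae_eq_zero_of_integral_contDiff_smul_eq_zero hf.locallyIntegrable fun g hg hgs => ?_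
  obtain ⟨C, hC⟩ := hgs.exists_bound_of_continuous hg.continuous
  have hgf : Integrable (fun x => g x • f x) μ :=
    hf.bdd_smul C hg.continuous.aestronglyMeasurable (ae_of_all _ hC)
  refine ext_inner_left ℝ fun e => ?_
  let b : E →ᵇ E := .ofNormedAddCommGroup (fun x => g x • e) (hg.continuous.smul continuous_const)
    (C * ‖e‖) fun x => (norm_smul_le _ _).trans (by gcongr; exact hC x)
  rw [inner_zero_right, ← h b, ← integral_inner hgf]
  simp [b, real_inner_smul_left, real_inner_smul_right]

end TestFunctions

lemma condKernel_comp_fst {α β : Type*} [MeasurableSpace α] [MeasurableSpace β]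
    [StandardBorelSpace β] [Nonempty β] (π : Measure (α × β)) [IsFiniteMeasure π] :
    π.condKernel ∘ₘ π.fst = π.snd := by
  rw [← Measure.snd_compProd, π.disintegrate]

variable {d : ℕ} {η ν : Measure (Rd d)}

lemma ConvexOrder.integral_add_nonneg [IsFiniteMeasure η] [IsFiniteMeasure ν]
    (hην : ConvexOrder η ν) (hη : MemLp id 2 η) (hν : MemLp id 2 ν) {b : Rd d →ᵇ Rd d}
    {g h : quadGrowth (Rd d)} (hb : martingaleTest b ≤ tensorSum (g, h)) :
    0 ≤ ∫ x, g x ∂η + ∫ y, h y ∂ν := by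
  obtain ⟨ψ, hψ, hgψ, hψh⟩ := exists_convexOn_between hb
  have hψν : Integrable ψ ν := integrable_of_le_of_le
    hψ.locallyLipschitz.continuous.aestronglyMeasurable (ae_of_all _ hgψ) (ae_of_all _ hψh)
    (quadGrowth.integrable hν g).neg (quadGrowth.integrable hν h)
  obtain ⟨hψη, hle⟩ := (convexOrder_iff (hη.integrable one_le_two) (hν.integrable one_le_two)).1
    hην ψ hψ hψν
  rw [← neg_le_iff_add_nonneg', ← integral_neg]
  calc ∫ x, -g x ∂η ≤ ∫ x, ψ x ∂η := integral_mono (quadGrowth.integrable hη g).neg hψη hgψ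
    _ ≤ ∫ y, ψ y ∂ν := hle
    _ ≤ ∫ y, h y ∂ν := integral_mono hψν (quadGrowth.integrable hν h) hψh

lemma ConvexOrder.exists_martingale_coupling [IsProbabilityMeasure η] [IsProbabilityMeasure ν]
    (hην : ConvexOrder η ν) (hη : MemLp id 2 η) (hν : MemLp id 2 ν) :
    ∃ π : Measure (Rd d × Rd d), π.fst = η ∧ π.snd = ν ∧
      ∀ b, ∫ p, martingaleTest b p ∂π = 0 := by
  obtain ⟨π, hfst, hsnd, hπ⟩ := exists_coupling_integral_nonneg hη hν
    (.ofSubmodule martingaleTest.range) <| by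
      rintro g h _ ⟨b, rfl⟩ hb
      exact hην.integral_add_nonneg hη hν hb
  refine ⟨π, hfst, hsnd, fun b => le_antisymm ?_ (hπ _ ⟨b, rfl⟩)⟩
  have hneg := hπ _ ⟨-b, rfl⟩
  rw [map_neg] at hneg
  exact neg_nonneg.1 (hneg.trans_eq (integral_neg _))

lemma integral_martingaleTest_compProd {m : Kernel (Rd d) (Rd d)} [IsMarkovKernel m]
    [IsFiniteMeasure η] (hη : MemLp id 2 η) (hm : MemLp id 2 (m ∘ₘ η)) (b : Rd d →ᵇ Rd d) :
    ∫ p, martingaleTest b p ∂(η ⊗ₘ m) = ∫ x, inner ℝ (b x) (barycenterMap m x - x) ∂η := by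
  have hηm : MemLp id 2 (η ⊗ₘ m) :=
    memLp_id_of_marginals (by rwa [Measure.fst_compProd]) (by rwa [Measure.snd_compProd])
  rw [Measure.integral_compProd (quadGrowth.integrable hηm _)]
  refine integral_congr_ae ?_
  filter_upwards [Measure.ae_integrable_of_integrable_comp (hm.integrable one_le_two)]
    with x (hx : Integrable (fun y => y) (m x))
  calc ∫ y, inner ℝ (b x) (y - x) ∂m x = inner ℝ (b x) (∫ y, (y - x) ∂m x) :=
        integral_inner (hx.sub (integrable_const x)) _
    _ = inner ℝ (b x) (barycenterMap m x - x) := by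
        rw [integral_sub hx (integrable_const x), integral_const, probReal_univ, one_smul,
          barycenterMap]

/-- Strassen's theorem. -/
theorem ConvexOrder.exists_martingale_kernel [IsProbabilityMeasure η] [IsProbabilityMeasure ν]
    (hην : ConvexOrder η ν) (hη : MemLp id 2 η) (hν : MemLp id 2 ν) :
    ∃ m : Kernel (Rd d) (Rd d), IsMarkovKernel m ∧ m ∘ₘ η = ν ∧ barycenterMap m =ᵐ[η] id := by
  obtain ⟨π, rfl, rfl, hπ⟩ := hην.exists_martingale_coupling hη hν
  have := isProbabilityMeasure_of_fst (π := π) inferInstance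
  have hm : MemLp id 2 (π.condKernel ∘ₘ π.fst) := by rwa [condKernel_comp_fst]
  refine ⟨π.condKernel, inferInstance, condKernel_comp_fst π, (sub_ae_eq_zero _ _).1 ?_⟩
  refine ae_eq_zero_of_integral_inner_eq_zero ((integrable_barycenterMap
    (hm.integrable one_le_two)).sub (hη.integrable one_le_two)) fun b => ?_
  have h := integral_martingaleTest_compProd hη hm b
  rw [π.disintegrate, hπ b] at h
  exact h.symm

end Strassen

section Correlation

lemma norm_sq_mem_quadGrowth {E : Type*} [NormedAddCommGroup E] :
    (fun x : E => ‖x‖ ^ 2) ∈ quadGrowth E :=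
  mem_quadGrowth_of_abs_le (C := 1) (by fun_prop) fun x => by
    rw [abs_of_nonneg (by positivity), one_mul]
    exact le_add_of_nonneg_left zero_le_one

lemma inner_mem_quadGrowth {E : Type*} [NormedAddCommGroup E] [InnerProductSpace ℝ E] :
    (fun p : E × E => inner ℝ p.1 p.2) ∈ quadGrowth (E × E) :=
  mem_quadGrowth_of_abs_le (C := 1) (by fun_prop) fun p => by
    calc |inner ℝ p.1 p.2| ≤ ‖p.1‖ * ‖p.2‖ := abs_real_inner_le_norm _ _
      _ ≤ ‖p‖ * ‖p‖ := by gcongr; exacts [norm_fst_le p, norm_snd_le p]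
      _ ≤ 1 * (1 + ‖p‖ ^ 2) := by linarith [sq ‖p‖]

variable {d : ℕ} {μ ν η : Measure (Rd d)} {π ρ : Measure (Rd d × Rd d)}

/-- The correlation `∫ ⟪x, y⟫ dπ(x, y)` of the two coordinates under `π`. Between couplings of the
same marginals, the quadratic cost differs from `-2 * correlation` by a constant only. -/
noncomputable def correlation (π : Measure (Rd d × Rd d)) : ℝ := ∫ p, inner ℝ p.1 p.2 ∂π

/-- The largest correlation of a coupling of `μ` and `ν`. It is attained for `μ, ν ∈ P2 d`, but the
supremum may have a junk value otherwise. -/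
noncomputable def maxCorrelation (μ ν : Measure (Rd d)) : ℝ := sSup (correlation '' couplings μ ν)

lemma isProbabilityMeasure_of_mem_couplings (hμ : μ ∈ P2 d) (hπ : π ∈ couplings μ ν) :
    IsProbabilityMeasure π :=
  isProbabilityMeasure_of_fst (hπ.1.symm ▸ hμ.1 : IsProbabilityMeasure (π.map Prod.fst))

lemma integrable_of_mem_couplings (hμ : μ ∈ P2 d) (hν : ν ∈ P2 d) (hπ : π ∈ couplings μ ν)
    (F : quadGrowth (Rd d × Rd d)) : Integrable F π := by
  have := isProbabilityMeasure_of_mem_couplings hμ hπ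
  obtain ⟨rfl, rfl⟩ := hπ
  exact quadGrowth.integrable (memLp_id_of_marginals (mem_P2_iff.1 hμ).2 (mem_P2_iff.1 hν).2) F

lemma integrable_inner_of_mem_couplings (hμ : μ ∈ P2 d) (hν : ν ∈ P2 d)
    (hπ : π ∈ couplings μ ν) : Integrable (fun p => inner ℝ p.1 p.2) π :=
  integrable_of_mem_couplings hμ hν hπ ⟨_, inner_mem_quadGrowth⟩

lemma isGreatest_maxCorrelation (hμ : μ ∈ P2 d) (hν : ν ∈ P2 d) :
    IsGreatest (correlation '' couplings μ ν) (maxCorrelation μ ν) := by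
  obtain ⟨_, hμ⟩ := mem_P2_iff.1 hμ
  obtain ⟨_, hν⟩ := mem_P2_iff.1 hν
  obtain ⟨π, hfst, hsnd, hmax⟩ :=
    exists_coupling_integral_maximal hμ hν ⟨_, inner_mem_quadGrowth⟩
  have hπ : IsGreatest (correlation '' couplings μ ν) (correlation π) :=
    ⟨⟨π, ⟨hfst, hsnd⟩, rfl⟩, forall_mem_image.2 fun ρ hρ => hmax ρ hρ.1 hρ.2⟩
  rwa [maxCorrelation, hπ.csSup_eq]

lemma correlation_le_maxCorrelation (hμ : μ ∈ P2 d) (hν : ν ∈ P2 d) (hπ : π ∈ couplings μ ν) :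
    correlation π ≤ maxCorrelation μ ν :=
  (isGreatest_maxCorrelation hμ hν).2 ⟨π, hπ, rfl⟩

section QuadraticCost

variable (hμ : μ ∈ P2 d) (hν : ν ∈ P2 d)

include hμ hν

lemma integral_norm_sub_sq (hπ : π ∈ couplings μ ν) :
    ∫ p, ‖p.2 - p.1‖ ^ 2 ∂π
      = ∫ x, ‖x‖ ^ 2 ∂μ + ∫ y, ‖y‖ ^ 2 ∂ν - 2 * correlation π := by
  have := isProbabilityMeasure_of_mem_couplings hμ hπ
  let normSq : quadGrowth (Rd d) := ⟨_, norm_sq_mem_quadGrowth⟩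
  have hsum := integrable_of_mem_couplings hμ hν hπ (tensorSum (normSq, normSq))
  have hinner := integrable_inner_of_mem_couplings hμ hν hπ
  obtain ⟨rfl, rfl⟩ := hπ
  calc ∫ p, ‖p.2 - p.1‖ ^ 2 ∂π
      = ∫ p, tensorSum (normSq, normSq) p - 2 * inner ℝ p.1 p.2 ∂π := by
        refine integral_congr_ae (ae_of_all _ fun p => ?_)
        change ‖p.2 - p.1‖ ^ 2 = ‖p.1‖ ^ 2 + ‖p.2‖ ^ 2 - 2 * inner ℝ p.1 p.2
        rw [norm_sub_sq_real, real_inner_comm]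
        ring
    _ = _ := by
        rw [integral_sub hsum (hinner.const_mul 2), integral_const_mul,
          integral_tensorSum (mem_P2_iff.1 hμ).2 (mem_P2_iff.1 hν).2]
        rfl

lemma quadCost_eq_ofReal (hπ : π ∈ couplings μ ν) :
    quadCost π = ENNReal.ofReal (∫ p, ‖p.2 - p.1‖ ^ 2 ∂π) := by
  have := isProbabilityMeasure_of_mem_couplings hμ hπ
  obtain ⟨rfl, rfl⟩ := hπ
  have hsub : MemLp (fun p : Rd d × Rd d => p.2 - p.1) 2 π :=
    ((mem_P2_iff.1 hν).2.comp_measurePreserving ⟨measurable_snd, rfl⟩).sub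
      ((mem_P2_iff.1 hμ).2.comp_measurePreserving ⟨measurable_fst, rfl⟩)
  rw [quadCost, ofReal_integral_eq_lintegral_ofReal hsub.norm.integrable_sq
    (ae_of_all _ fun p => by positivity)]
  exact lintegral_congr fun p => by rw [ENNReal.ofReal_pow (norm_nonneg _), ofReal_norm]

lemma toReal_quadCost (hπ : π ∈ couplings μ ν) :
    (quadCost π).toReal = ∫ x, ‖x‖ ^ 2 ∂μ + ∫ y, ‖y‖ ^ 2 ∂ν - 2 * correlation π := by
  rw [quadCost_eq_ofReal hμ hν hπ,
    ENNReal.toReal_ofReal (integral_nonneg fun p => by positivity), integral_norm_sub_sq hμ hν hπ]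

lemma quadCost_le_quadCost_iff (hπ : π ∈ couplings μ ν) (hρ : ρ ∈ couplings μ ν) :
    quadCost π ≤ quadCost ρ ↔ correlation ρ ≤ correlation π := by
  have hne {σ : Measure (Rd d × Rd d)} (hσ : σ ∈ couplings μ ν) : quadCost σ ≠ ∞ :=
    quadCost_eq_ofReal hμ hν hσ ▸ ENNReal.ofReal_ne_top
  rw [← ENNReal.toReal_le_toReal (hne hπ) (hne hρ), toReal_quadCost hμ hν hπ,
    toReal_quadCost hμ hν hρ]
  constructor <;> intro h <;> linarith

lemma mem_optCouplings_iff :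
    π ∈ optCouplings μ ν ↔ π ∈ couplings μ ν ∧ correlation π = maxCorrelation μ ν := by
  refine and_congr_right fun hπ => ?_
  have hW : quadCost π = W2sq μ ν ↔ ∀ ρ ∈ couplings μ ν, quadCost π ≤ quadCost ρ := by
    rw [eq_comm, W2sq, ← (iInf₂_le π hπ).ge_iff_eq, le_iInf₂_iff]
  rw [hW, ← (correlation_le_maxCorrelation hμ hν hπ).ge_iff_eq,
    isLUB_le_iff (isGreatest_maxCorrelation hμ hν).isLUB, mem_upperBounds, forall_mem_image]
  exact forall₂_congr fun ρ hρ => quadCost_le_quadCost_iff hμ hν hπ hρ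

lemma toReal_W2sq :
    (W2sq μ ν).toReal = ∫ x, ‖x‖ ^ 2 ∂μ + ∫ y, ‖y‖ ^ 2 ∂ν - 2 * maxCorrelation μ ν := by
  obtain ⟨π, hπ, hmax⟩ := (isGreatest_maxCorrelation hμ hν).1
  rw [← ((mem_optCouplings_iff hμ hν).2 ⟨hπ, hmax⟩).2, toReal_quadCost hμ hν hπ, hmax]

lemma mem_setI_iff :
    η ∈ setI μ ν ↔ η ∈ P2 d ∧ ConvexOrder η ν ∧ maxCorrelation μ η = maxCorrelation μ ν := by
  refine and_congr_right fun hη => and_congr_right fun _ => ?_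
  rw [toReal_W2sq hμ hν, toReal_W2sq hμ hη]
  constructor <;> intro h <;> linarith

end QuadraticCost

section Kernel

variable {k k' : Kernel (Rd d) (Rd d)} [IsMarkovKernel k] [IsMarkovKernel k']

lemma compProd_mem_couplings [SFinite μ] : μ ⊗ₘ k ∈ couplings μ (k ∘ₘ μ) :=
  ⟨Measure.fst_compProd μ k, Measure.snd_compProd μ k⟩

lemma exists_compProd_eq_of_mem_couplings [IsFiniteMeasure π] (hπ : π ∈ couplings μ ν) :
    ∃ k : Kernel (Rd d) (Rd d), IsMarkovKernel k ∧ k ∘ₘ μ = ν ∧ μ ⊗ₘ k = π := by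
  obtain ⟨rfl, rfl⟩ := hπ
  exact ⟨π.condKernel, inferInstance, condKernel_comp_fst π, π.disintegrate π.condKernel⟩

lemma correlation_compProd (hμ : μ ∈ P2 d) (hk : k ∘ₘ μ ∈ P2 d) :
    correlation (μ ⊗ₘ k) = ∫ x, inner ℝ x (barycenterMap k x) ∂μ := by
  have := hμ.1
  rw [correlation, Measure.integral_compProd
    (integrable_inner_of_mem_couplings hμ hk compProd_mem_couplings)]
  refine integral_congr_ae ?_
  filter_upwards [Measure.ae_integrable_of_integrable_comp (integrable_id_of_mem_P2 hk)]
    with x hx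
  exact integral_inner hx x

lemma correlation_compProd_congr (hμ : μ ∈ P2 d) (hk : k ∘ₘ μ ∈ P2 d) (hk' : k' ∘ₘ μ ∈ P2 d)
    (h : barycenterMap k =ᵐ[μ] barycenterMap k') :
    correlation (μ ⊗ₘ k) = correlation (μ ⊗ₘ k') := by
  rw [correlation_compProd hμ hk, correlation_compProd hμ hk']
  exact integral_congr_ae (h.mono fun x hx => congrArg (inner ℝ x) hx)

lemma exists_kernel_correlation_eq_maxCorrelation (hμ : μ ∈ P2 d) (hν : ν ∈ P2 d) :
    ∃ k : Kernel (Rd d) (Rd d), IsMarkovKernel k ∧ k ∘ₘ μ = ν ∧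
      correlation (μ ⊗ₘ k) = maxCorrelation μ ν := by
  obtain ⟨π, hπ, hmax⟩ := (isGreatest_maxCorrelation hμ hν).1
  have := isProbabilityMeasure_of_mem_couplings hμ hπ
  obtain ⟨k, hk, hkν, rfl⟩ := exists_compProd_eq_of_mem_couplings hπ
  exact ⟨k, hk, hkν, hmax⟩

lemma ConvexOrder.exists_kernel_barycenterMap_ae_eq (hk : k ∘ₘ μ ∈ P2 d)
    (hν : ν ∈ P2 d) (h : ConvexOrder (k ∘ₘ μ) ν) :
    ∃ k' : Kernel (Rd d) (Rd d), IsMarkovKernel k' ∧ k' ∘ₘ μ = ν ∧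
      barycenterMap k' =ᵐ[μ] barycenterMap k := by
  have := hν.1
  have := hk.1
  obtain ⟨m, _, rfl, hmid⟩ :=
    h.exists_martingale_kernel (mem_P2_iff.1 hk).2 (mem_P2_iff.1 hν).2
  exact ⟨m ∘ₖ k, inferInstance, Measure.comp_assoc.symm,
    barycenterMap_comp_ae_eq (integrable_id_of_mem_P2 hν) hmid⟩

end Kernel

lemma ConvexOrder.maxCorrelation_le (hμ : μ ∈ P2 d) (hη : η ∈ P2 d) (hν : ν ∈ P2 d)
    (h : ConvexOrder η ν) : maxCorrelation μ η ≤ maxCorrelation μ ν := by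
  have := hμ.1
  obtain ⟨k, _, rfl, hk⟩ := exists_kernel_correlation_eq_maxCorrelation hμ hη
  obtain ⟨k', _, rfl, hbar⟩ := h.exists_kernel_barycenterMap_ae_eq hη hν
  rw [← hk, ← correlation_compProd_congr hμ hν hη hbar]
  exact correlation_le_maxCorrelation hμ hν compProd_mem_couplings

end Correlation

section Mixtures

section General

variable {X : Type*} [MeasurableSpace X] {μ₁ μ₂ : Measure X} {f : X → ℝ}

lemma integrable_mixture (h₁ : Integrable f μ₁) (h₂ : Integrable f μ₂) (a b : ℝ≥0) :
    Integrable f (a • μ₁ + b • μ₂) :=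
  h₁.smul_measure_nnreal.add_measure h₂.smul_measure_nnreal

lemma integral_mixture (h₁ : Integrable f μ₁) (h₂ : Integrable f μ₂) (a b : ℝ≥0) :
    ∫ x, f x ∂(a • μ₁ + b • μ₂) = a * ∫ x, f x ∂μ₁ + b * ∫ x, f x ∂μ₂ := by
  rw [integral_add_measure h₁.smul_measure_nnreal h₂.smul_measure_nnreal,
    integral_smul_nnreal_measure, integral_smul_nnreal_measure]
  rfl

end General

variable {d : ℕ} {μ ν η₁ η₂ : Measure (Rd d)} {a b : ℝ≥0}

lemma convex_P2 : Convex ℝ≥0 (P2 d) := by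
  rintro η₁ ⟨_, h₁⟩ η₂ ⟨_, h₂⟩ a b - - hab
  refine ⟨⟨?_⟩, ?_⟩
  · change (a : ℝ≥0∞) * η₁ univ + b * η₂ univ = 1
    rw [measure_univ, measure_univ, mul_one, mul_one]
    exact_mod_cast hab
  · rw [lintegral_add_measure, lintegral_smul_measure, lintegral_smul_measure]
    exact ENNReal.add_lt_top.2 ⟨ENNReal.mul_lt_top ENNReal.coe_lt_top h₁,
      ENNReal.mul_lt_top ENNReal.coe_lt_top h₂⟩

lemma ConvexOrder.mixture (hη₁ : η₁ ∈ P2 d) (hη₂ : η₂ ∈ P2 d) (hν : ν ∈ P2 d) (hab : a + b = 1)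
    (h₁ : ConvexOrder η₁ ν) (h₂ : ConvexOrder η₂ ν) : ConvexOrder (a • η₁ + b • η₂) ν := by
  have hη := convex_P2 hη₁ hη₂ a.2 b.2 hab
  have := hη₁.1; have := hη₂.1; have := hν.1; have := hη.1
  have hν' := integrable_id_of_mem_P2 hν
  refine (convexOrder_iff (integrable_id_of_mem_P2 hη) hν').2 fun φ hφ hφν => ?_
  obtain ⟨hφ₁, hle₁⟩ := (convexOrder_iff (integrable_id_of_mem_P2 hη₁) hν').1 h₁ φ hφ hφν
  obtain ⟨hφ₂, hle₂⟩ := (convexOrder_iff (integrable_id_of_mem_P2 hη₂) hν').1 h₂ φ hφ hφν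
  refine ⟨integrable_mixture hφ₁ hφ₂ a b, ?_⟩
  calc ∫ x, φ x ∂(a • η₁ + b • η₂) = a * ∫ x, φ x ∂η₁ + b * ∫ x, φ x ∂η₂ :=
        integral_mixture hφ₁ hφ₂ a b
    _ ≤ a * ∫ x, φ x ∂ν + b * ∫ x, φ x ∂ν := by gcongr
    _ = ∫ x, φ x ∂ν := by rw [← add_mul, ← NNReal.coe_add, hab, NNReal.coe_one, one_mul]

lemma mixture_mem_couplings {π₁ π₂ : Measure (Rd d × Rd d)} (h₁ : π₁ ∈ couplings μ η₁)
    (h₂ : π₂ ∈ couplings μ η₂) (hab : a + b = 1) :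
    a • π₁ + b • π₂ ∈ couplings μ (a • η₁ + b • η₂) := by
  constructor
  · rw [Measure.map_add _ _ measurable_fst, Measure.map_smul, Measure.map_smul, h₁.1, h₂.1,
      ← add_smul, hab, one_smul]
  · rw [Measure.map_add _ _ measurable_snd, Measure.map_smul, Measure.map_smul, h₁.2, h₂.2]

lemma le_maxCorrelation_mixture (hμ : μ ∈ P2 d) (hη₁ : η₁ ∈ P2 d) (hη₂ : η₂ ∈ P2 d)
    (hab : a + b = 1) :
    a * maxCorrelation μ η₁ + b * maxCorrelation μ η₂ ≤ maxCorrelation μ (a • η₁ + b • η₂) := by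
  obtain ⟨π₁, hπ₁, hmax₁⟩ := (isGreatest_maxCorrelation hμ hη₁).1
  obtain ⟨π₂, hπ₂, hmax₂⟩ := (isGreatest_maxCorrelation hμ hη₂).1
  calc a * maxCorrelation μ η₁ + b * maxCorrelation μ η₂
      = a * correlation π₁ + b * correlation π₂ := by rw [hmax₁, hmax₂]
    _ = correlation (a • π₁ + b • π₂) :=
        (integral_mixture (integrable_inner_of_mem_couplings hμ hη₁ hπ₁)
          (integrable_inner_of_mem_couplings hμ hη₂ hπ₂) a b).symm
    _ ≤ maxCorrelation μ (a • η₁ + b • η₂) :=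
        correlation_le_maxCorrelation hμ (convex_P2 hη₁ hη₂ a.2 b.2 hab)
          (mixture_mem_couplings hπ₁ hπ₂ hab)

end Mixtures

section SetI

variable {d : ℕ} {μ ν η η' : Measure (Rd d)} (hμ : μ ∈ P2 d) (hν : ν ∈ P2 d)

include hμ hν

lemma mem_setI_iff_le :
    η ∈ setI μ ν ↔ η ∈ P2 d ∧ ConvexOrder η ν ∧ maxCorrelation μ ν ≤ maxCorrelation μ η :=
  (mem_setI_iff hμ hν).trans <| and_congr_right fun hη => and_congr_right fun h =>
    (h.maxCorrelation_le hμ hη hν).ge_iff_eq.symm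

lemma convex_setI : Convex ℝ≥0 (setI μ ν) := by
  intro η₁ h₁ η₂ h₂ a b ha hb hab
  obtain ⟨hη₁, hcx₁, heq₁⟩ := (mem_setI_iff hμ hν).1 h₁
  obtain ⟨hη₂, hcx₂, heq₂⟩ := (mem_setI_iff hμ hν).1 h₂
  refine (mem_setI_iff_le hμ hν).2 ⟨convex_P2 hη₁ hη₂ ha hb hab,
    hcx₁.mixture hη₁ hη₂ hν hab hcx₂, ?_⟩
  calc maxCorrelation μ ν = a * maxCorrelation μ η₁ + b * maxCorrelation μ η₂ := by
        rw [heq₁, heq₂, ← add_mul, ← NNReal.coe_add, hab, NNReal.coe_one, one_mul]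
    _ ≤ maxCorrelation μ (a • η₁ + b • η₂) := le_maxCorrelation_mixture hμ hη₁ hη₂ hab

lemma mem_setI_of_between [IsProbabilityMeasure η'] (hη : η ∈ setI μ ν)
    (h₁ : ConvexOrder η η') (h₂ : ConvexOrder η' ν) : η' ∈ setI μ ν ∧ η ∈ setI μ η' := by
  have hη' := h₂.mem_P2 hν
  obtain ⟨hη₂, -, hle⟩ := (mem_setI_iff_le hμ hν).1 hη
  exact ⟨(mem_setI_iff_le hμ hν).2 ⟨hη', h₂, hle.trans (h₁.maxCorrelation_le hμ hη₂ hη')⟩,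
    (mem_setI_iff_le hμ hη').2 ⟨hη₂, h₁, (h₂.maxCorrelation_le hμ hη' hν).trans hle⟩⟩

lemma setITilde_subset_setI : setITilde μ ν ⊆ setI μ ν := by
  rintro _ ⟨k, _, hk, rfl⟩
  have := hμ.1
  obtain ⟨hkν, hopt⟩ := (mem_optCouplings_iff hμ hν).1 hk
  obtain rfl : k ∘ₘ μ = ν := (Measure.snd_compProd μ k).symm.trans hkν.2
  have hT : Measurable (barycenterMap k) := measurable_barycenterMap
  have hcx := convexOrder_map_barycenterMap (integrable_id_of_mem_P2 hν)
  have := Measure.isProbabilityMeasure_map (μ := μ) hT.aemeasurable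
  have hη := hcx.mem_P2 hν
  refine (mem_setI_iff_le hμ hν).2 ⟨hη, hcx, ?_⟩
  have hbar : barycenterMap k =ᵐ[μ] barycenterMap (.deterministic _ hT) :=
    ae_of_all _ fun x => (integral_dirac id (barycenterMap k x)).symm
  rw [← Measure.deterministic_comp_eq_map hT] at hη ⊢
  rw [← hopt, correlation_compProd_congr hμ hν hη hbar]
  exact correlation_le_maxCorrelation hμ hη compProd_mem_couplings

lemma exists_setITilde_convexOrder (hη : η ∈ setI μ ν) : ∃ θ ∈ setITilde μ ν, ConvexOrder θ η := by
  have := hμ.1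
  obtain ⟨hη₂, hcx, heq⟩ := (mem_setI_iff hμ hν).1 hη
  obtain ⟨k, _, rfl, hk⟩ := exists_kernel_correlation_eq_maxCorrelation hμ hη₂
  obtain ⟨k', _, rfl, hbar⟩ := hcx.exists_kernel_barycenterMap_ae_eq hη₂ hν
  have hopt : correlation (μ ⊗ₘ k') = maxCorrelation μ (k' ∘ₘ μ) := by
    rw [correlation_compProd_congr hμ hν hη₂ hbar, hk, heq]
  refine ⟨μ.map (barycenterMap k'), ⟨k', inferInstance,
    (mem_optCouplings_iff hμ hν).2 ⟨compProd_mem_couplings, hopt⟩, rfl⟩, ?_⟩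
  rw [Measure.map_congr hbar]
  exact convexOrder_map_barycenterMap (integrable_id_of_mem_P2 hη₂)

end SetI

theorem lemma3 (d : ℕ) (μ ν : Measure (Rd d)) (hμ : μ ∈ P2 d) (hν : ν ∈ P2 d) :
    (∀ η ∈ setI μ ν, ∀ η' : Measure (Rd d), IsProbabilityMeasure η' →
      ConvexOrder η η' → ConvexOrder η' ν → η' ∈ setI μ ν ∧ η ∈ setI μ η') ∧
    setI μ ν = {η | η ∈ P2 d ∧ ∃ θ ∈ setITilde μ ν, ConvexOrder θ η ∧ ConvexOrder η ν} ∧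
    Convex ℝ≥0 (setI μ ν) := by
  refine ⟨fun η hη η' _ h₁ h₂ => mem_setI_of_between hμ hν hη h₁ h₂, Set.ext fun η => ⟨?_, ?_⟩,
    convex_setI hμ hν⟩
  · intro hη
    obtain ⟨θ, hθ, h⟩ := exists_setITilde_convexOrder hμ hν hη
    exact ⟨hη.1, θ, hθ, h, hη.2.1⟩
  · rintro ⟨hη, θ, hθ, h₁, h₂⟩
    have := hη.1
    exact (mem_setI_of_between hμ hν (setITilde_subset_setI hμ hν hθ) h₁ h₂).1
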